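/- Let $R\subseteq S$ be an extension of commutative rings with unit, and let $[R,S]$ be the lattice of $R$-subalgebras of $S$ ordered by inclusion; the infimum of $T,U\in[R,S]$ is $T\cap U$ and their supremum is the compositum $TU$. Assume that $R\subseteq S$ has FCP, i.e. that every chain in $[R,S]$ is finite, and that $R\subseteq S$ is subintegral, i.e. that it is integral, that the natural map $\mathrm{Spec}(S)\to\mathrm{Spec}(R)$ is bijective, and that for each $Q\in\mathrm{Spec}(S)$, with $P:=Q\cap R$, the residual extension $R_P/PR_P\to S_Q/QS_Q$ is an isomorphism. Then $R\subseteq S$ is distributive (i.e. in the lattice $[R,S]$ intersection and compositum are each distributive with respect to the other) if and only if $R\subseteq S$ is arithmetic (i.e. for each prime ideal $P$ of $R$, the lattice $[R_P,S_P]$ of $R_P$-subalgebras of $S_P$ is a chain, where $S_P:=S_{R\setminus P}$). -/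

import Mathlib

namespace RingExt

/-- `R ⊆ S` has FCP: every chain of `R`-subalgebras of `S` is finite. -/
def HasFCP (R : Type*) (S : Type*) [CommRing R] [CommRing S] [Algebra R S] : Prop :=
  ∀ C : Set (Subalgebra R S), IsChain (· ≤ ·) C → C.Finite

/-- `R ⊆ S` is chained: any two `R`-subalgebras of `S` are comparable. -/
def IsChained (R : Type*) (S : Type*) [CommRing R] [CommRing S] [Algebra R S] : Prop :=
  IsChain (· ≤ ·) (Set.univ : Set (Subalgebra R S))

/-- `R ⊆ S` is distributive: in the lattice of `R`-subalgebras of `S`, intersection (`⊓`) and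
product, that is compositum (`⊔`), are each distributive with respect to the other. -/
def IsDistributive (R : Type*) (S : Type*) [CommRing R] [CommRing S] [Algebra R S] : Prop :=
  (∀ T U V : Subalgebra R S, T ⊓ (U ⊔ V) = (T ⊓ U) ⊔ (T ⊓ V)) ∧
  (∀ T U V : Subalgebra R S, T ⊔ (U ⊓ V) = (T ⊔ U) ⊓ (T ⊔ V))

/-- `R ⊆ S` is arithmetic: `R_P ⊆ S_P` is chained for each prime ideal `P` of `R`, where `S_P` is
the localization of the ring `S` at the image of `R ∖ P`. -/
def IsArithmetic (R : Type*) (S : Type*) [CommRing R] [CommRing S] [Algebra R S] : Prop :=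
  ∀ (P : Ideal R) [P.IsPrime],
    IsChained (Localization.AtPrime P)
      (Localization (Algebra.algebraMapSubmonoid S P.primeCompl))

/-- `R ⊆ S` is subintegral: it is integral, the map `Spec S → Spec R` is bijective, and every
residual field extension `κ_R(Q ∩ R) → κ_S(Q)` is an isomorphism. -/
structure IsSubintegral (R : Type*) (S : Type*) [CommRing R] [CommRing S] [Algebra R S] :
    Prop where
  isIntegral : Algebra.IsIntegral R S
  residue_bijective : ∀ (Q : Ideal S) [Q.IsPrime],
    Function.Bijective (Ideal.ResidueField.map (Q.comap (algebraMap R S)) Q (algebraMap R S) rfl)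
  spec_bijective : Function.Bijective (PrimeSpectrum.comap (algebraMap R S))

end RingExt

/-!
If `R ⊆ S` is arithmetic, distributivity holds because equality of subalgebras can be checked
locally: at a prime `P`, one of `U_P`, `V_P` contains the other, so every `x ∈ T ∩ UV` has a
multiple `sx`, `s ∉ P`, in `T ∩ U` or in `T ∩ V` (`IsArithmetic.inf_sup_eq`). This direction needs
neither FCP nor subintegrality.

Conversely, let `R ⊆ S` be distributive. Distributivity and FCP pass from `R ⊆ S` to `A ⊆ B` whenever
every element of `B` comes from `S` up to units of `A` that come from `R`: contraction to `S` is an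
order embedding which respects suprema up to such denominators (`HasFCP.transfer`,
`inf_sup_transfer`). This applies to `R_P ⊆ S_P` and to `W ⊆ S_P` for each intermediate ring `W`.
By subintegrality `S_P` is local and `R_P` surjects onto the residue field of `S_P`. If `T`, `U` are
incomparable in `[R_P, S_P]`, then FCP provides two distinct atoms `U'`, `V'` over the local
ring `A = T ∩ U`.

The core is that two such atoms contradict distributivity (`not_isDistributive_of_isAtom`). Let `𝔪`
be the maximal ideal of `A`. Nakayama's lemma gives `𝔪U' ⊆ A`, and minimality then forces
`U' = A + Au` with `u` a nonunit and `u² ∈ 𝔪`; likewise `V'` contains such a `v`, outside `A`. Now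
`D = A + A(u + v) + Auv` is a ring with `U' ∩ D = A`, although `u = (u + v) - v ∈ V'D`. So
`U' ∩ V'D` contains `u`, while `(U' ∩ V')(U' ∩ D) = A` does not.
-/

namespace RingExt

open IsLocalRing

/-! ### Atoms over a local ring with trivial residual extension -/

section Local

variable {A B : Type*} [CommRing A] [CommRing B] [Algebra A B]

/-- The subalgebra `A + zU` of `U`, for `z ∈ U`. -/
def addMul (U : Subalgebra A B) (z : B) (hz : z ∈ U) : Subalgebra A B where
  carrier := {y | ∃ a : A, ∃ x ∈ U, y = algebraMap A B a + z * x}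
  mul_mem' := by
    rintro _ _ ⟨a, x, hx, rfl⟩ ⟨b, y, hy, rfl⟩
    refine ⟨a * b, algebraMap A B a * y + algebraMap A B b * x + z * x * y, ?_, ?_⟩
    · exact U.add_mem (U.add_mem (U.mul_mem (U.algebraMap_mem a) hy)
        (U.mul_mem (U.algebraMap_mem b) hx)) (U.mul_mem (U.mul_mem hz hx) hy)
    · rw [map_mul]; ring
  add_mem' := by
    rintro _ _ ⟨a, x, hx, rfl⟩ ⟨b, y, hy, rfl⟩
    exact ⟨a + b, x + y, U.add_mem hx hy, by rw [map_add]; ring⟩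
  algebraMap_mem' a := ⟨a, 0, U.zero_mem, by simp⟩

/-- If `U` is an atom, then `A + zU` is `A` or `U`. -/
lemma mul_mem_bot_or_eq_of_isAtom {U : Subalgebra A B} (hU : IsAtom U) {z : B} (hz : z ∈ U) :
    (∀ x ∈ U, z * x ∈ (⊥ : Subalgebra A B)) ∨
      ∀ y ∈ U, ∃ a : A, ∃ x ∈ U, y = algebraMap A B a + z * x := by
  have hle : addMul U z hz ≤ U := by
    rintro _ ⟨a, x, hx, rfl⟩
    exact U.add_mem (U.algebraMap_mem a) (U.mul_mem hz hx)
  rcases hU.le_iff.1 hle with h | h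
  · left
    intro x hx
    rw [← h]
    exact ⟨0, x, hx, by simp⟩
  · right
    intro y hy
    rw [← h] at hy
    exact hy

/-- The subalgebra `A + A(u + v) + Auv`, for `u`, `v` with `u²`, `v²`, `u²v` and `v²u` in `A`. -/
def diagonal (u v : B) (m₁ m₂ e₁ e₂ : A) (hu : u * u = algebraMap A B m₁)
    (hv : v * v = algebraMap A B m₂) (huv : algebraMap A B m₁ * v = algebraMap A B e₁)
    (hvu : algebraMap A B m₂ * u = algebraMap A B e₂) : Subalgebra A B where
  carrier := {y | ∃ a b c : A,
    y = algebraMap A B a + algebraMap A B b * (u + v) + algebraMap A B c * (u * v)}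
  mul_mem' := by
    rintro _ _ ⟨a, b, c, rfl⟩ ⟨a', b', c', rfl⟩
    refine ⟨a * a' + b * b' * (m₁ + m₂) + (b * c' + b' * c) * (e₁ + e₂) + c * c' * (m₁ * m₂),
      a * b' + b * a', a * c' + c * a' + 2 * (b * b'), ?_⟩
    simp only [map_mul, map_add, map_ofNat, ← huv, ← hvu, ← hu, ← hv]
    ring
  add_mem' := by
    rintro _ _ ⟨a, b, c, rfl⟩ ⟨a', b', c', rfl⟩
    exact ⟨a + a', b + b', c + c', by simp only [map_add]; ring⟩
  algebraMap_mem' a := ⟨a, 0, 0, by simp⟩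

variable [Algebra.IsIntegral A B]

/-- In an atom `U`, any element of the maximal ideal outside `A` generates `U` as an algebra;
by integrality `U` is then a finite `A`-module. Nakayama's lemma excludes `U = A + mU`. -/
lemma maximalIdeal_mul_mem_bot_of_isAtom [IsLocalRing A] {U : Subalgebra A B} (hU : IsAtom U)
    {m : A} (hm : m ∈ maximalIdeal A) {x : B} (hx : x ∈ U) :
    algebraMap A B m * x ∈ (⊥ : Subalgebra A B) := by
  rcases mul_mem_bot_or_eq_of_isAtom hU (U.algebraMap_mem m) with h | h
  · exact h x hx
  exfalso
  obtain ⟨u, hu, hu'⟩ := SetLike.exists_of_lt hU.bot_lt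
  have hadj : Algebra.adjoin A {u} = U := by
    rcases hU.le_iff.1 (Algebra.adjoin_le (Set.singleton_subset_iff.2 hu)) with h | h
    · exact (hu' (h ▸ Algebra.self_mem_adjoin_singleton A u)).elim
    · exact h
  have hfg : (Subalgebra.toSubmodule U).FG := by
    rw [← hadj]
    exact (Algebra.IsIntegral.isIntegral u).fg_adjoin_singleton
  have hle := Submodule.le_of_le_smul_of_le_jacobson_bot
    (N := Subalgebra.toSubmodule (⊥ : Subalgebra A B)) hfg (maximalIdeal_le_jacobson ⊥) (by
      intro y hy
      obtain ⟨a, x, hx, rfl⟩ := h y hy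
      refine Submodule.add_mem_sup (Subalgebra.algebraMap_mem _ a) ?_
      rw [← Algebra.smul_def]
      exact Submodule.smul_mem_smul hm hx)
  exact hu' (hle hu)

variable [IsLocalRing B]

lemma exists_mul_eq_one_of_notMem_maximalIdeal (U : Subalgebra A B) {x : B} (hx : x ∈ U)
    (hx' : x ∉ maximalIdeal B) : ∃ y ∈ U, x * y = 1 := by
  have : Algebra.IsIntegral U B := Algebra.IsIntegral.tower_top A
  have h : IsUnit (algebraMap U B ⟨x, hx⟩) := by simpa using hx'
  obtain ⟨y, hy⟩ := (isUnit_of_map_unit _ _ h).exists_right_inv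
  exact ⟨y, y.2, congrArg Subtype.val hy⟩

variable [FaithfulSMul A B]

lemma algebraMap_mem_maximalIdeal_iff [IsLocalRing A] {a : A} :
    algebraMap A B a ∈ maximalIdeal B ↔ a ∈ maximalIdeal A := by
  simp

/-- If `U` were `A + u²U`, then `u(1 - ux) ∈ A` for some `x ∈ U`, where `1 - ux` is a unit
of `U`, so that `u` would lie in `𝔪U ⊆ A`, for `𝔪` the maximal ideal of `A`. -/
lemma mul_self_mem_bot_of_isAtom [IsLocalRing A] {U : Subalgebra A B} (hU : IsAtom U)
    {u : B} (hu : u ∈ U) (hun : u ∈ maximalIdeal B) (hu' : u ∉ (⊥ : Subalgebra A B)) :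
    u * u ∈ (⊥ : Subalgebra A B) := by
  rcases mul_mem_bot_or_eq_of_isAtom hU (U.mul_mem hu hu) with h | h
  · simpa using h 1 U.one_mem
  exfalso
  obtain ⟨a, x, hx, hux⟩ := h u hu
  have ha : a ∈ maximalIdeal A := by
    rw [← algebraMap_mem_maximalIdeal_iff (B := B)]
    have : algebraMap A B a = u * (1 - u * x) := by linear_combination -hux
    rw [this]
    exact Ideal.mul_mem_right _ _ hun
  have h1 : 1 - u * x ∉ maximalIdeal B := fun h1 ↦ by
    have := Ideal.add_mem _ h1 (Ideal.mul_mem_right x _ hun)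
    rw [sub_add_cancel] at this
    exact (Ideal.ne_top_iff_one _).1 (maximalIdeal.isMaximal B).ne_top this
  obtain ⟨y, hy, hxy⟩ := exists_mul_eq_one_of_notMem_maximalIdeal U
    (U.sub_mem U.one_mem (U.mul_mem hu hx)) h1
  have : u = algebraMap A B a * y := by linear_combination (-u) * hxy + y * hux
  exact hu' (this ▸ maximalIdeal_mul_mem_bot_of_isAtom hU ha hy)

/-- With trivial residual extension, an atom is generated over `A` by a nonunit `u` with
`u² ∈ A`, and then `U = A + Au`. -/
lemma exists_generator_of_isAtom [IsLocalRing A]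
    (hres : ∀ x : B, ∃ a : A, x - algebraMap A B a ∈ maximalIdeal B)
    {U : Subalgebra A B} (hU : IsAtom U) :
    ∃ u ∈ U, u ∈ maximalIdeal B ∧ u ∉ (⊥ : Subalgebra A B) ∧
      (∃ m ∈ maximalIdeal A, u * u = algebraMap A B m) ∧
      ∀ y ∈ U, ∃ a b : A, y = algebraMap A B a + algebraMap A B b * u := by
  obtain ⟨w, hw, hw'⟩ := SetLike.exists_of_lt hU.bot_lt
  obtain ⟨r, hr⟩ := hres w
  have huU : w - algebraMap A B r ∈ U := U.sub_mem hw (U.algebraMap_mem r)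
  have hu' : w - algebraMap A B r ∉ (⊥ : Subalgebra A B) := fun h ↦
    hw' (by simpa using Subalgebra.add_mem _ h (Subalgebra.algebraMap_mem ⊥ r))
  generalize w - algebraMap A B r = u at hr huU hu'
  obtain ⟨m, hm⟩ := Algebra.mem_bot.1 (mul_self_mem_bot_of_isAtom hU huU hr hu')
  have hmM : m ∈ maximalIdeal A := by
    rw [← algebraMap_mem_maximalIdeal_iff (B := B), hm]
    exact Ideal.mul_mem_right _ _ hr
  refine ⟨u, huU, hr, hu', ⟨m, hmM, hm.symm⟩, fun y hy ↦ ?_⟩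
  rcases mul_mem_bot_or_eq_of_isAtom hU huU with h | h
  · exact (hu' (by simpa using h 1 U.one_mem)).elim
  -- expand `y = a + u x` and `x = b + u x'`; the remainder `u² x'` is in `𝔪U ⊆ A`
  obtain ⟨a, x, hx, rfl⟩ := h y hy
  obtain ⟨b, x', hx', rfl⟩ := h x hx
  obtain ⟨c, hc⟩ := Algebra.mem_bot.1 (maximalIdeal_mul_mem_bot_of_isAtom hU hmM hx')
  refine ⟨a + c, b, ?_⟩
  rw [map_add, hc, hm]
  ring

/-- Distinct atoms `U = A + Au` and `V = A + Av` violate distributivity: the subalgebra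
`D = A + A(u + v) + Auv` meets `U` in `A` only, while `u ∈ V ⊔ D`. -/
theorem not_isDistributive_of_isAtom [IsLocalRing A]
    (hres : ∀ x : B, ∃ a : A, x - algebraMap A B a ∈ maximalIdeal B)
    (hdist : ∀ T U V : Subalgebra A B, T ⊓ (U ⊔ V) = (T ⊓ U) ⊔ (T ⊓ V))
    {U V : Subalgebra A B} (hU : IsAtom U) (hV : IsAtom V) (hne : U ≠ V) : False := by
  have hdisj : U ⊓ V = ⊥ := (hU.disjoint_of_ne hV hne).eq_bot
  obtain ⟨u, huU, hun, hu', ⟨m₁, hm₁, hu⟩, hgen⟩ := exists_generator_of_isAtom hres hU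
  obtain ⟨v, hvV, hvn, hv', ⟨m₂, hm₂, hv⟩, -⟩ := exists_generator_of_isAtom hres hV
  obtain ⟨e₁, he₁⟩ := Algebra.mem_bot.1 (maximalIdeal_mul_mem_bot_of_isAtom hV hm₁ hvV)
  obtain ⟨e₂, he₂⟩ := Algebra.mem_bot.1 (maximalIdeal_mul_mem_bot_of_isAtom hU hm₂ huU)
  have huV : u ∉ V := fun h ↦ hu' (hdisj ▸ ⟨huU, h⟩)
  have hvU : v ∉ U := fun h ↦ hv' (hdisj ▸ ⟨h, hvV⟩)
  set D := diagonal u v m₁ m₂ e₁ e₂ hu hv he₁.symm he₂.symm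
  have hUD : U ⊓ D = ⊥ := by
    refine le_bot_iff.1 ?_
    rintro _ ⟨hy, a, b, c, rfl⟩
    have hy1 : algebraMap A B b * (u + v) + algebraMap A B c * (u * v) ∈ U := by
      have := U.sub_mem hy (U.algebraMap_mem a)
      rwa [add_assoc, add_sub_cancel_left] at this
    -- otherwise `b + cu` is a unit of `U` and `v(b + cu) ∈ U`
    have hb : b ∈ maximalIdeal A := by
      by_contra hb
      have hbc : algebraMap A B b + algebraMap A B c * u ∉ maximalIdeal B := fun h ↦ hb <| by
        rw [← algebraMap_mem_maximalIdeal_iff (B := B)]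
        exact (Ideal.add_mem_iff_left _ (Ideal.mul_mem_left _ _ hun)).1 h
      obtain ⟨z, hz, hbz⟩ := exists_mul_eq_one_of_notMem_maximalIdeal U
        (U.add_mem (U.algebraMap_mem b) (U.mul_mem (U.algebraMap_mem c) huU)) hbc
      refine hvU ?_
      have := U.mul_mem (U.sub_mem hy1 (U.mul_mem (U.algebraMap_mem b) huU)) hz
      convert this using 1
      linear_combination -v * hbz
    have hbuv : algebraMap A B b * (u + v) ∈ (⊥ : Subalgebra A B) := by
      rw [mul_add]
      exact Subalgebra.add_mem _ (maximalIdeal_mul_mem_bot_of_isAtom hU hb huU)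
        (maximalIdeal_mul_mem_bot_of_isAtom hV hb hvV)
    have hc : algebraMap A B c * (u * v) ∈ U := by
      have := U.sub_mem hy1 ((bot_le : ⊥ ≤ U) hbuv)
      rwa [add_sub_cancel_left] at this
    refine Subalgebra.add_mem _ (Subalgebra.add_mem _ (Subalgebra.algebraMap_mem _ a) hbuv) ?_
    obtain ⟨a', b', h'⟩ := hgen _ hc
    -- `u(cv - b') = a'`; if `b'` is a unit, then so is `cv - b' ∈ V`, and `u ∈ V`
    have hb' : b' ∈ maximalIdeal A := by
      by_contra hb'
      have hcv : algebraMap A B c * v - algebraMap A B b' ∉ maximalIdeal B := fun h ↦ hb' <| by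
        rw [← algebraMap_mem_maximalIdeal_iff (B := B)]
        have := Ideal.sub_mem _ (Ideal.mul_mem_left _ (algebraMap A B c) hvn) h
        rwa [sub_sub_cancel] at this
      obtain ⟨z, hz, hcz⟩ := exists_mul_eq_one_of_notMem_maximalIdeal V
        (V.sub_mem (V.mul_mem (V.algebraMap_mem c) hvV) (V.algebraMap_mem b')) hcv
      have : u = algebraMap A B a' * z := by linear_combination (-u) * hcz + z * h'
      exact huV (this ▸ V.mul_mem (V.algebraMap_mem a') hz)
    rw [h']
    exact Subalgebra.add_mem _ (Subalgebra.algebraMap_mem _ a')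
      (maximalIdeal_mul_mem_bot_of_isAtom hU hb' huU)
  have huVD : u ∈ U ⊓ (V ⊔ D) := by
    refine ⟨huU, ?_⟩
    have huvD : u + v ∈ D := ⟨0, 1, 0, by simp⟩
    have := (V ⊔ D).sub_mem ((le_sup_right : D ≤ V ⊔ D) huvD) ((le_sup_left : V ≤ V ⊔ D) hvV)
    rwa [add_sub_cancel_right] at this
  rw [hdist, hdisj, hUD, sup_idem] at huVD
  exact hu' huVD

end Local

/-! ### Transfer of FCP and distributivity -/

section Transfer

variable {R S A B : Type*} [CommRing R] [CommRing S] [CommRing A] [CommRing B] [Algebra R S]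
  [Algebra R A] [Algebra R B] [Algebra A B] [IsScalarTower R A B]

/-- The `R`-subalgebra of `S` obtained by contracting an `A`-subalgebra of `B` along `S → B`. -/
def contract (φ : S →ₐ[R] B) (X : Subalgebra A B) : Subalgebra R S :=
  (X.restrictScalars R).comap φ

lemma mem_contract {φ : S →ₐ[R] B} {X : Subalgebra A B} {y : S} :
    y ∈ contract φ X ↔ φ y ∈ X := Iff.rfl

variable (A) in
/-- Every element of `B` is carried into the image of `S` by an element of `R` that is a unit
of `A`. This covers localizations as well as a change of the base ring inside `S`. -/
def HasDenominators (φ : S →ₐ[R] B) : Prop :=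
  ∀ b : B, ∃ s : R, IsUnit (algebraMap R A s) ∧ ∃ y : S, algebraMap R B s * b = φ y

lemma mem_of_algebraMap_mul_mem (X : Subalgebra A B) {s : R} (hs : IsUnit (algebraMap R A s))
    {b : B} (h : algebraMap R B s * b ∈ X) : b ∈ X := by
  obtain ⟨t, ht⟩ := hs.exists_right_inv
  have h1 : algebraMap R B s * algebraMap A B t = 1 := by
    rw [IsScalarTower.algebraMap_apply R A B, ← map_mul, ht, map_one]
  have := X.mul_mem (X.algebraMap_mem t) h
  convert this using 1
  linear_combination (-b) * h1

lemma algebraMap_mul_mem (X : Subalgebra A B) (s : R) {b : B} (h : b ∈ X) :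
    algebraMap R B s * b ∈ X := by
  rw [IsScalarTower.algebraMap_apply R A B]
  exact X.mul_mem (X.algebraMap_mem _) h

lemma contract_le_contract_iff {φ : S →ₐ[R] B} (hφ : HasDenominators A φ)
    {X Y : Subalgebra A B} : contract φ X ≤ contract φ Y ↔ X ≤ Y := by
  refine ⟨fun h b hb ↦ ?_, fun h y hy ↦ h hy⟩
  obtain ⟨s, hs, y, hy⟩ := hφ b
  refine mem_of_algebraMap_mul_mem Y hs ?_
  rw [hy]
  exact h (mem_contract.2 (hy ▸ algebraMap_mul_mem X s hb))

lemma HasFCP.transfer {φ : S →ₐ[R] B} (hφ : HasDenominators A φ) (h : HasFCP R S) :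
    HasFCP A B := by
  intro C hC
  have hinj : Function.Injective (contract (A := A) φ) := fun X Y hXY ↦
    le_antisymm ((contract_le_contract_iff hφ).1 hXY.le) ((contract_le_contract_iff hφ).1 hXY.ge)
  refine Set.Finite.of_finite_image (h _ ?_) hinj.injOn
  rintro _ ⟨X, hX, rfl⟩ _ ⟨Y, hY, rfl⟩ -
  rcases hC.total hX hY with h | h
  · exact Or.inl ((contract_le_contract_iff hφ).2 h)
  · exact Or.inr ((contract_le_contract_iff hφ).2 h)

/-- Contraction need not preserve suprema, but an element of `X ⊔ Y` lies in the supremum of the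
contractions after multiplication by a denominator. -/
lemma exists_mul_mem_contract_sup {φ : S →ₐ[R] B} (hφ : HasDenominators A φ)
    {X Y : Subalgebra A B} {b : B} (hb : b ∈ X ⊔ Y) :
    ∃ s : R, IsUnit (algebraMap R A s) ∧
      ∃ y ∈ contract φ X ⊔ contract φ Y, algebraMap R B s * b = φ y := by
  have key : ∀ Z : Subalgebra A B, contract φ Z ≤ contract φ X ⊔ contract φ Y → ∀ b ∈ Z,
      ∃ s : R, IsUnit (algebraMap R A s) ∧
        ∃ y ∈ contract φ X ⊔ contract φ Y, algebraMap R B s * b = φ y := by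
    intro Z hZ b hb
    obtain ⟨s, hs, y, hy⟩ := hφ b
    exact ⟨s, hs, y, hZ (mem_contract.2 (hy ▸ algebraMap_mul_mem Z s hb)), hy⟩
  rw [Algebra.sup_def] at hb
  induction hb using Algebra.adjoin_induction with
  | mem b hb =>
    rcases hb with hb | hb
    · exact key X le_sup_left b hb
    · exact key Y le_sup_right b hb
  | algebraMap a => exact key X le_sup_left _ (X.algebraMap_mem a)
  | add b c _ _ hb hc =>
    obtain ⟨s, hs, y, hy, hsy⟩ := hb
    obtain ⟨t, ht, z, hz, htz⟩ := hc
    refine ⟨s * t, by rw [map_mul]; exact hs.mul ht, t • y + s • z,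
      add_mem (Subalgebra.smul_mem _ hy t) (Subalgebra.smul_mem _ hz s), ?_⟩
    simp only [map_add, map_mul, Algebra.smul_def, AlgHom.commutes, ← hsy, ← htz]
    ring
  | mul b c _ _ hb hc =>
    obtain ⟨s, hs, y, hy, hsy⟩ := hb
    obtain ⟨t, ht, z, hz, htz⟩ := hc
    refine ⟨s * t, by rw [map_mul]; exact hs.mul ht, y * z, mul_mem hy hz, ?_⟩
    simp only [map_mul, ← hsy, ← htz]
    ring

lemma inf_sup_transfer {φ : S →ₐ[R] B} (hφ : HasDenominators A φ)
    (h : ∀ T U V : Subalgebra R S, T ⊓ (U ⊔ V) = (T ⊓ U) ⊔ (T ⊓ V)) (X Y Z : Subalgebra A B) :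
    X ⊓ (Y ⊔ Z) = (X ⊓ Y) ⊔ (X ⊓ Z) := by
  refine le_antisymm ?_ le_inf_sup
  rintro b ⟨hbX, hb⟩
  obtain ⟨s, hs, y, hy, hsy⟩ := exists_mul_mem_contract_sup hφ hb
  have hyX : y ∈ contract φ X := mem_contract.2 (hsy ▸ algebraMap_mul_mem X s hbX)
  have hmem : y ∈ contract φ X ⊓ (contract φ Y ⊔ contract φ Z) := ⟨hyX, hy⟩
  rw [h] at hmem
  have hle : contract φ X ⊓ contract φ Y ⊔ contract φ X ⊓ contract φ Z ≤
      contract φ (X ⊓ Y ⊔ X ⊓ Z) :=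
    sup_le (fun y hy ↦ (le_sup_left : X ⊓ Y ≤ X ⊓ Y ⊔ X ⊓ Z) hy)
      (fun y hy ↦ (le_sup_right : X ⊓ Z ≤ X ⊓ Y ⊔ X ⊓ Z) hy)
  refine mem_of_algebraMap_mul_mem _ hs ?_
  rw [hsy]
  exact hle hmem

end Transfer

/-! ### Incomparable subalgebras give distinct atoms -/

lemma HasFCP.wellFounded_lt {R S : Type*} [CommRing R] [CommRing S] [Algebra R S]
    (h : HasFCP R S) : WellFounded ((· < ·) : Subalgebra R S → Subalgebra R S → Prop) := by
  refine RelEmbedding.wellFounded_iff_isEmpty.2 ⟨fun f ↦ ?_⟩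
  refine Set.infinite_range_of_injective f.injective (h _ ?_)
  rintro _ ⟨i, rfl⟩ _ ⟨j, rfl⟩ -
  rcases lt_trichotomy i j with hij | rfl | hij
  · exact Or.inr (f.map_rel_iff.2 hij).le
  · exact Or.inl le_rfl
  · exact Or.inl (f.map_rel_iff.2 hij).le

/-- The subalgebra `T ⊇ W`, regarded as an algebra over `W`. -/
def overSubalgebra {A B : Type*} [CommRing A] [CommRing B] [Algebra A B] {W T : Subalgebra A B}
    (h : W ≤ T) : Subalgebra W B where
  carrier := T
  mul_mem' := T.mul_mem
  add_mem' := T.add_mem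
  algebraMap_mem' w := h w.2

/-- Two incomparable `T`, `U` give, by the descending chain condition, two distinct atoms
over `W = T ∩ U`. The local ring `W` inherits all hypotheses. -/
theorem isChained_of_inf_sup {A B : Type*} [CommRing A] [CommRing B] [Algebra A B]
    [IsLocalRing B] [Algebra.IsIntegral A B] (hFCP : HasFCP A B)
    (hres : ∀ x : B, ∃ a : A, x - algebraMap A B a ∈ maximalIdeal B)
    (hdist : ∀ T U V : Subalgebra A B, T ⊓ (U ⊔ V) = (T ⊓ U) ⊔ (T ⊓ V)) : IsChained A B := by
  rintro T - U - -
  by_contra! hTU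
  set W := T ⊓ U
  have : Algebra.IsIntegral W B := Algebra.IsIntegral.tower_top A
  have : IsLocalRing W := RingHom.domain_isLocalRing (algebraMap W B)
  have hden : HasDenominators W (AlgHom.id A B) := fun b ↦
    ⟨1, by rw [map_one]; exact isUnit_one, b, by simp⟩
  have hatomic := isAtomic_of_orderBot_wellFounded_lt (hFCP.transfer hden).wellFounded_lt
  have hne : ∀ {X : Subalgebra A B} (hX : W ≤ X), ¬ X ≤ W → overSubalgebra hX ≠ ⊥ := by
    intro X hX hXW h
    refine hXW fun x hx ↦ ?_
    have hx' : x ∈ overSubalgebra hX := hx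
    rw [h] at hx'
    obtain ⟨w, rfl⟩ := Algebra.mem_bot.1 hx'
    exact w.2
  obtain ⟨T', hT', hTT'⟩ := (hatomic.eq_bot_or_exists_atom_le _).resolve_left
    (hne (inf_le_left : W ≤ T) fun h ↦ hTU.1 (h.trans inf_le_right))
  obtain ⟨U', hU', hUU'⟩ := (hatomic.eq_bot_or_exists_atom_le _).resolve_left
    (hne (inf_le_right : W ≤ U) fun h ↦ hTU.2 (h.trans inf_le_left))
  refine not_isDistributive_of_isAtom (fun x ↦ ?_) (inf_sup_transfer hden hdist) hT' hU' ?_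
  · obtain ⟨a, ha⟩ := hres x
    exact ⟨algebraMap A W a, ha⟩
  · rintro rfl
    refine hT'.1 (le_bot_iff.1 fun x hx ↦ ?_)
    exact Algebra.mem_bot.2 ⟨⟨x, hTT' hx, hUU' hx⟩, rfl⟩

/-! ### Localization at a prime -/

section Localization

variable {R S : Type*} [CommRing R] [CommRing S] [Algebra R S]

/-- Surjectivity of `κ_R(Q ∩ R) → κ_S(Q)`, with denominators cleared. -/
lemma IsSubintegral.exists_mul_sub_mem (h : IsSubintegral R S) (Q : Ideal S) [Q.IsPrime] (x : S) :
    ∃ a b : R, algebraMap R S b ∉ Q ∧ algebraMap R S b * x - algebraMap R S a ∈ Q := by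
  obtain ⟨z, hz⟩ := (h.residue_bijective Q).2 (algebraMap S Q.ResidueField x)
  obtain ⟨a', b', hb', rfl⟩ := IsFractionRing.div_surjective (A := R ⧸ Q.comap (algebraMap R S)) z
  obtain ⟨a, rfl⟩ := Ideal.Quotient.mk_surjective a'
  obtain ⟨b, rfl⟩ := Ideal.Quotient.mk_surjective b'
  have hmap : ∀ r : R, Ideal.ResidueField.map (Q.comap (algebraMap R S)) Q (algebraMap R S) rfl
      (algebraMap (R ⧸ Q.comap (algebraMap R S)) _ (Ideal.Quotient.mk _ r)) =
      algebraMap S Q.ResidueField (algebraMap R S r) := by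
    intro r
    rw [Ideal.algebraMap_quotient_residueField_mk, Ideal.ResidueField.map_algebraMap]
  have hb : algebraMap R S b ∉ Q := fun hb ↦ by
    refine nonZeroDivisors.ne_zero hb' ?_
    exact Ideal.Quotient.eq_zero_iff_mem.2 hb
  refine ⟨a, b, hb, ?_⟩
  rw [← Ideal.algebraMap_residueField_eq_zero, map_sub, map_mul, ← hz, map_div₀, hmap, hmap,
    mul_div_cancel₀, sub_self]
  rwa [Ne, Ideal.algebraMap_residueField_eq_zero]

variable (P : Ideal R) [P.IsPrime]

/-- The localization of `S` at the image of `R ∖ P`. -/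
local notation "SP" => Localization (Algebra.algebraMapSubmonoid S P.primeCompl)

/-- Every maximal ideal of `S_P` contracts to a prime of `S` over `P`, and there is only one. -/
lemma IsSubintegral.exists_maximalIdeal_eq_map (h : IsSubintegral R S) :
    ∃ (Q : Ideal S) (_ : Q.IsPrime) (_ : IsLocalRing SP), Q.comap (algebraMap R S) = P ∧
      maximalIdeal SP = Q.map (algebraMap S SP) := by
  have := h.isIntegral
  obtain ⟨⟨Q, hQ⟩, hQP⟩ := h.spec_bijective.2 ⟨P, inferInstance⟩
  replace hQP : Q.comap (algebraMap R S) = P := congrArg PrimeSpectrum.asIdeal hQP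
  have hmax : ∀ I : Ideal SP, I.IsMaximal → I = Q.map (algebraMap S SP) := by
    intro I hI
    rw [← IsLocalization.map_under (Algebra.algebraMapSubmonoid S P.primeCompl) SP I]
    congr 1
    have hI' : (I.comap (algebraMap (Localization.AtPrime P) SP)) =
        maximalIdeal (Localization.AtPrime P) :=
      eq_maximalIdeal (Ideal.isMaximal_comap_of_isIntegral_of_isMaximal I)
    have hp : (I.comap (algebraMap S SP)).IsPrime := inferInstance
    have : PrimeSpectrum.comap (algebraMap R S) ⟨I.comap (algebraMap S SP), hp⟩ =
        PrimeSpectrum.comap (algebraMap R S) ⟨Q, hQ⟩ := by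
      ext1
      change (I.comap (algebraMap S SP)).comap (algebraMap R S) = Q.comap (algebraMap R S)
      rw [hQP, Ideal.comap_comap, ← IsScalarTower.algebraMap_eq,
        IsScalarTower.algebraMap_eq R (Localization.AtPrime P) SP, ← Ideal.comap_comap, hI']
      exact Localization.AtPrime.under_maximalIdeal
    exact congrArg PrimeSpectrum.asIdeal (h.spec_bijective.1 this)
  have hnt : Nontrivial SP := by
    by_contra hnt
    rw [not_nontrivial_iff_subsingleton,
      IsLocalization.subsingleton_iff (M := Algebra.algebraMapSubmonoid S P.primeCompl)] at hnt
    obtain ⟨r, hr, hr0⟩ := hnt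
    exact hr (hQP ▸ Ideal.mem_comap.2 (hr0 ▸ Q.zero_mem))
  obtain ⟨I, hI⟩ := Ideal.exists_maximal SP
  have hloc : IsLocalRing SP :=
    .of_unique_max_ideal ⟨I, hI, fun J hJ ↦ (hmax J hJ).trans (hmax I hI).symm⟩
  exact ⟨Q, hQ, hloc, hQP, hmax _ (maximalIdeal.isMaximal _)⟩

lemma isChained_localization_of_inf_sup (hFCP : HasFCP R S) (h : IsSubintegral R S)
    (hdist : ∀ T U V : Subalgebra R S, T ⊓ (U ⊔ V) = (T ⊓ U) ⊔ (T ⊓ V)) :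
    IsChained (Localization.AtPrime P) SP := by
  have := h.isIntegral
  obtain ⟨Q, hQ, hloc, hQP, hmax⟩ := h.exists_maximalIdeal_eq_map P
  have hden : HasDenominators (Localization.AtPrime P) (IsScalarTower.toAlgHom R S SP) := by
    intro b
    obtain ⟨y, ⟨_, s, hs, rfl⟩, rfl⟩ := IsLocalization.exists_mk'_eq
      (Algebra.algebraMapSubmonoid S P.primeCompl) b
    refine ⟨s, IsLocalization.map_units _ (⟨s, hs⟩ : P.primeCompl), y, ?_⟩
    rw [IsScalarTower.algebraMap_apply R S SP]
    exact IsLocalization.mk'_spec' SP y _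
  refine isChained_of_inf_sup (hFCP.transfer hden) (fun x ↦ ?_) (inf_sup_transfer hden hdist)
  obtain ⟨s, hs, y, hy⟩ := hden x
  obtain ⟨a, b, hb, hab⟩ := h.exists_mul_sub_mem Q y
  have hb' : IsUnit (algebraMap R (Localization.AtPrime P) b) :=
    IsLocalization.map_units _ (⟨b, fun hbP ↦ hb (by rwa [← hQP] at hbP)⟩ : P.primeCompl)
  obtain ⟨c, hc⟩ := (hb'.mul hs).exists_right_inv
  have hc' := congrArg (algebraMap (Localization.AtPrime P) SP) hc
  simp only [map_mul, map_one, ← IsScalarTower.algebraMap_apply] at hc'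
  refine ⟨algebraMap R _ a * c, ?_⟩
  rw [hmax]
  have hmem := Ideal.mul_mem_left _ (algebraMap (Localization.AtPrime P) SP c)
    (Ideal.mem_map_of_mem (algebraMap S SP) hab)
  convert hmem using 1
  simp only [map_mul, map_sub, ← IsScalarTower.algebraMap_apply]
  simp only [IsScalarTower.toAlgHom_apply] at hy
  rw [← hy]
  linear_combination (-x) * hc'

variable {P} in
/-- The `R_P`-subalgebra `T_P` of `S_P`. -/
def localize (T : Subalgebra R S) : Subalgebra (Localization.AtPrime P) SP where
  carrier := {x | ∃ s ∉ P, ∃ t ∈ T, algebraMap R SP s * x = algebraMap S SP t}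
  mul_mem' := by
    rintro x y ⟨s, hs, t, ht, hx⟩ ⟨s', hs', t', ht', hy⟩
    refine ⟨s * s', P.primeCompl.mul_mem hs hs', t * t', T.mul_mem ht ht', ?_⟩
    rw [map_mul, map_mul, ← hx, ← hy]
    ring
  add_mem' := by
    rintro x y ⟨s, hs, t, ht, hx⟩ ⟨s', hs', t', ht', hy⟩
    refine ⟨s * s', P.primeCompl.mul_mem hs hs', algebraMap R S s' * t + algebraMap R S s * t',
      T.add_mem (T.mul_mem (T.algebraMap_mem _) ht) (T.mul_mem (T.algebraMap_mem _) ht'), ?_⟩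
    simp only [map_mul, map_add, ← hx, ← hy, ← IsScalarTower.algebraMap_apply]
    ring
  algebraMap_mem' a := by
    obtain ⟨r, s, rfl⟩ := IsLocalization.exists_mk'_eq P.primeCompl a
    refine ⟨s, s.2, algebraMap R S r, T.algebraMap_mem r, ?_⟩
    rw [IsScalarTower.algebraMap_apply R (Localization.AtPrime P) SP, ← map_mul,
      IsLocalization.mk'_spec', ← IsScalarTower.algebraMap_apply,
      ← IsScalarTower.algebraMap_apply]

variable {P}

/-! ### Arithmetic extensions are distributive -/

lemma exists_smul_mem_of_localize_le {T U : Subalgebra R S}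
    (h : localize (P := P) T ≤ localize U) {t : S} (ht : t ∈ T) : ∃ s ∉ P, s • t ∈ U := by
  obtain ⟨s, hs, u, hu, hsu⟩ := h
    (show algebraMap S SP t ∈ localize T from ⟨1, P.primeCompl.one_mem, t, ht, by simp⟩)
  rw [IsScalarTower.algebraMap_apply R S SP, ← map_mul] at hsu
  obtain ⟨⟨_, s', hs', rfl⟩, hs'u⟩ := (IsLocalization.eq_iff_exists
    (Algebra.algebraMapSubmonoid S P.primeCompl) SP).1 hsu
  refine ⟨s' * s, P.primeCompl.mul_mem hs' hs, ?_⟩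
  rw [Algebra.smul_def, map_mul, mul_assoc, hs'u]
  exact U.mul_mem (U.algebraMap_mem s') hu

lemma exists_smul_mem_of_mem_sup {T U : Subalgebra R S}
    (h : localize (P := P) T ≤ localize U) {x : S} (hx : x ∈ T ⊔ U) : ∃ s ∉ P, s • x ∈ U := by
  rw [Algebra.sup_def] at hx
  induction hx using Algebra.adjoin_induction with
  | mem x hx =>
    rcases hx with hx | hx
    · exact exists_smul_mem_of_localize_le h hx
    · exact ⟨1, P.primeCompl.one_mem, by rwa [one_smul]⟩
  | algebraMap r => exact ⟨1, P.primeCompl.one_mem, by rw [one_smul]; exact U.algebraMap_mem r⟩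
  | add x y _ _ hx hy =>
    obtain ⟨s, hs, hx⟩ := hx
    obtain ⟨t, ht, hy⟩ := hy
    refine ⟨s * t, P.primeCompl.mul_mem hs ht, ?_⟩
    rw [smul_add, mul_comm, mul_smul, mul_comm, mul_smul]
    exact U.add_mem (U.smul_mem hx t) (U.smul_mem hy s)
  | mul x y _ _ hx hy =>
    obtain ⟨s, hs, hx⟩ := hx
    obtain ⟨t, ht, hy⟩ := hy
    refine ⟨s * t, P.primeCompl.mul_mem hs ht, ?_⟩
    rw [← smul_mul_smul_comm]
    exact U.mul_mem hx hy

lemma IsArithmetic.inf_sup_eq (h : IsArithmetic R S) (T U V : Subalgebra R S) :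
    T ⊓ (U ⊔ V) = (T ⊓ U) ⊔ (T ⊓ V) := by
  refine le_antisymm ?_ le_inf_sup
  rintro x ⟨hxT, hx⟩
  -- the `r` with `rx ∈ (T ⊓ U) ⊔ (T ⊓ V)` form an ideal that lies in no maximal ideal
  set W := (T ⊓ U) ⊔ (T ⊓ V)
  let I : Ideal R := (Subalgebra.toSubmodule W).comap (LinearMap.toSpanSingleton R S x)
  have hI : I = ⊤ := by
    by_contra hI
    obtain ⟨P, hP, hIP⟩ := Ideal.exists_le_maximal I hI
    suffices ∃ s ∉ P, s • x ∈ W by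
      obtain ⟨s, hs, hsx⟩ := this
      exact hs (hIP (show s ∈ I by simpa [I] using hsx))
    rcases (h P).total (Set.mem_univ (localize U)) (Set.mem_univ (localize V)) with hUV | hUV
    · obtain ⟨s, hs, hsx⟩ := exists_smul_mem_of_mem_sup hUV hx
      exact ⟨s, hs, (le_sup_right : T ⊓ V ≤ W) ⟨T.smul_mem hxT s, hsx⟩⟩
    · obtain ⟨s, hs, hsx⟩ := exists_smul_mem_of_mem_sup hUV (sup_comm U V ▸ hx)
      exact ⟨s, hs, (le_sup_left : T ⊓ U ≤ W) ⟨T.smul_mem hxT s, hsx⟩⟩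
  have h1 : (1 : R) ∈ I := hI ▸ Submodule.mem_top
  simpa [I] using h1

lemma IsArithmetic.isDistributive (h : IsArithmetic R S) : IsDistributive R S := by
  refine ⟨h.inf_sup_eq, fun T U V ↦ ?_⟩
  rw [h.inf_sup_eq (T ⊔ U) T V, inf_comm (T ⊔ U) T, inf_sup_self, inf_comm (T ⊔ U) V,
    h.inf_sup_eq V T U, ← sup_assoc, inf_comm V T, sup_inf_self, inf_comm V U]

end Localization

end RingExt

theorem proposition6p7 {R : Type*} {S : Type*} [CommRing R] [CommRing S] [Algebra R S]
    (hinj : Function.Injective (algebraMap R S))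
    (hFCP : RingExt.HasFCP R S) (hsub : RingExt.IsSubintegral R S) :
    RingExt.IsDistributive R S ↔ RingExt.IsArithmetic R S :=
  ⟨fun h P _ ↦ RingExt.isChained_localization_of_inf_sup P hFCP hsub h.1,
    RingExt.IsArithmetic.isDistributive⟩
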